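/- **Theorem (Lifting and Lowering System Steps Across $\preceq$).** *Setting.* Fix a set of locations $\ell$ and a local language: expressions $e$ with variables $x$, capture-avoiding substitution satisfying the usual laws, closed values $v$ including $\mathsf{true},\mathsf{false}$, and a step relation $e\to e'$ under which values do not step. Let $d\in\{\mathbf L,\mathbf R\}$. All syntax is taken up to renaming of bound variables. *Control programs* are $$E ::= X \mid () \mid \mathsf{ret}(e)\mid \mathsf{if}\,e\,\mathsf{then}\,E_1\,\mathsf{else}\,E_2\mid \mathsf{send}\,e\,\mathsf{to}\,\ell;E\mid \mathsf{recv}\,x\,\mathsf{from}\,\ell;E\mid \mathsf{choose}\,d\,\mathsf{for}\,\ell;E\mid \mathsf{allow}\,\ell\,\{\mathbf L\Rightarrow E\}\mid \mathsf{allow}\,\ell\,\{\mathbf R\Rightarrow E\}\mid \mathsf{allow}\,\ell\,\{\mathbf L\Rightarrow E_1;\mathbf R\Rightarrow E_2\}\mid \mathsf{let}\,\mathsf{ret}(x)=E_1\,\mathsf{in}\,E_2\mid \mathsf{fun}\,F(x):=E\mid \mathsf{fun}\,F(X):=E\mid E\,e\mid E_1\,E_2 .$$ Values $V$ are $()$,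 $\mathsf{ret}(v)$ and closed functions. Labels are $l::=\iota\mid \mathsf{send}(v,\ell)\mid\mathsf{recv}(\ell,v)\mid\mathsf{choose}(d,\ell)\mid\mathsf{allow}(\ell,d)\mid\iota_{\mathrm{sync}}\mid\mathsf{fun}(l)\mid\mathsf{arg}(l)$. The relation $E\xrightarrow{l}E'$ is generated by: - a local step of the expression $e$ in $\mathsf{ret}(e)$, in the test of a conditional, in a message to be sent, or in the argument of $E\,e$, has label $\iota$; so has reducing a conditional on $\mathsf{true}$ or $\mathsf{false}$; - $\mathsf{send}\,v\,\mathsf{to}\,\ell;E\xrightarrow{\mathsf{send}(v,\ell)}E$, $\ \mathsf{recv}\,x\,\mathsf{from}\,\ell;E\xrightarrow{\mathsf{recv}(\ell,v)}E[x\mapsto v]$ for every value $v$, $\ \mathsf{choose}\,d\,\mathsf{for}\,\ell;E\xrightarrow{\mathsf{choose}(d,\ell)}E$, and an external choice from $\ell$ that offers branch $d$ steps to that branch with label $\mathsf{allow}(\ell,d)$; - $\mathsf{let}\,\mathsf{ret}(x)=\mathsf{ret}(v)\,\mathsf{in}\,E\to E[x\mapsto v]$, $\ (\mathsf{fun}\,F(x):=E)\,v\to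 E[x\mapsto v,F\mapsto \mathsf{fun}\,F(x):=E]$ and $(\mathsf{fun}\,F(X):=E)\,V\to E[X\mapsto V,F\mapsto\mathsf{fun}\,F(X):=E]$, all with label $\iota_{\mathrm{sync}}$; - if $E_1\xrightarrow{l}E_1'$ then $E_1\,e\xrightarrow{\mathsf{fun}(l)}E_1'\,e$, $E_1\,E_2\xrightarrow{\mathsf{fun}(l)}E_1'\,E_2$, $E_2\,E_1\xrightarrow{\mathsf{arg}(l)}E_2\,E_1'$ and $\mathsf{let}\,\mathsf{ret}(x)=E_1\,\mathsf{in}\,E_2\xrightarrow{\mathsf{arg}(l)}\mathsf{let}\,\mathsf{ret}(x)=E_1'\,\mathsf{in}\,E_2$. *Systems.* A system $\Pi$ is a finite partial map from locations to control programs. System labels are $L::=\iota\mid \ell_1.v\rightsquigarrow\ell_2\mid \ell_1[d]\rightsquigarrow\ell_2\mid\iota_{\mathrm{sync}}$. Labels merge by $\iota\bowtie\iota=\iota$, $\iota_{\mathrm{sync}}\bowtie\iota_{\mathrm{sync}}=\iota_{\mathrm{sync}}$, $\mathsf{send}(v,\ell_2)\bowtie\mathsf{recv}(\ell_1,v)=\ell_1.v\rightsquigarrow\ell_2$,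 $\mathsf{choose}(d,\ell_2)\bowtie\mathsf{allow}(\ell_1,d)=\ell_1[d]\rightsquigarrow\ell_2$, and $\mathsf{fun}(l_1)\bowtie\mathsf{fun}(l_2)=\mathsf{arg}(l_1)\bowtie\mathsf{arg}(l_2)=l_1\bowtie l_2$. System steps $\Pi\xrightarrow{L}\Pi'$ are: one location takes a step with a label $l$ with $l\bowtie l=\iota$ (then $L=\iota$); every location of $\Pi$ takes a step with the same label $l$, where $l\bowtie l=\iota_{\mathrm{sync}}$ (then $L=\iota_{\mathrm{sync}}$); two distinct locations $\ell_1,\ell_2$ take steps with labels $l_1,l_2$, where $l_1\bowtie l_2=L$ is $\ell_1.v\rightsquigarrow\ell_2$ or $\ell_1[d]\rightsquigarrow\ell_2$. All other locations are unchanged. *Less nondeterminism.* $E_1\preceq E_2$ is the smallest relation that relates each of $X$, $()$, $\mathsf{ret}(e)$ and each function to itself, is compatible with all other constructs of the control language, and satisfies $\mathsf{allow}\,\ell\,\{\mathbf L\Rightarrow E\}\preceq\mathsf{allow}\,\ell\,\{\mathbf L\Rightarrow E_1;\mathbf R\Rightarrow E_2\}$ if $E\preceq E_1$, and $\mathsf{allow}\,\ell\,\{\mathbf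 R\Rightarrow E\}\preceq\mathsf{allow}\,\ell\,\{\mathbf L\Rightarrow E_1;\mathbf R\Rightarrow E_2\}$ if $E\preceq E_2$. For systems, $\Pi_1\preceq\Pi_2$ means that for every $\ell$ with $\Pi_1(\ell)$ defined, $\Pi_2(\ell)$ is defined and $\Pi_1(\ell)\preceq\Pi_2(\ell)$. *Projection.* Choreographies are $C::=X\mid \ell.e\mid \ell_1.e\rightsquigarrow\ell_2.x;C\mid \mathsf{if}\,\ell.e\,\mathsf{then}\,C_1\,\mathsf{else}\,C_2\mid\ell_1[d]\rightsquigarrow\ell_2;C\mid\mathsf{let}\,\ell.x:=C_1\,\mathsf{in}\,C_2\mid\mathsf{fun}_\ell\,F(x):=C\mid\mathsf{fun}\,F(X):=C\mid C\,(\ell.e)\mid C_1\,C_2$. The partial, commutative merge $E_1\sqcup E_2$ merges programs with the same outermost construct and the same expressions, locations and labels componentwise ($X$, $()$, $\mathsf{ret}(e)$ and functions only with themselves), and merges two external choices from the same location into the one that offers the branches of both, a branch offered by both being merged; it is undefined in all other cases. The partial endpoint projection $[\![C]\!]_\ell$ is given by: - $[\![X]\!]_\ell=X$; $[\![\ell_1.e]\!]_\ell$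 is $\mathsf{ret}(e)$ if $\ell=\ell_1$, else $()$; - $[\![\ell_1.e\rightsquigarrow\ell_2.x;C]\!]_\ell$ is $\mathsf{send}\,e\,\mathsf{to}\,\ell_2;[\![C]\!]_\ell$ if $\ell=\ell_1\ne\ell_2$, $\mathsf{recv}\,x\,\mathsf{from}\,\ell_1;[\![C]\!]_\ell$ if $\ell=\ell_2\neq\ell_1$, undefined if $\ell=\ell_1=\ell_2$, else $[\![C]\!]_\ell$; - $[\![\ell_1[d]\rightsquigarrow\ell_2;C]\!]_\ell$ is $\mathsf{choose}\,d\,\mathsf{for}\,\ell_2;[\![C]\!]_\ell$ if $\ell=\ell_1\ne\ell_2$, $\mathsf{allow}\,\ell_1\{d\Rightarrow[\![C]\!]_\ell\}$ if $\ell=\ell_2\ne\ell_1$, undefined if $\ell=\ell_1=\ell_2$, else $[\![C]\!]_\ell$; - $[\![\mathsf{if}\,\ell_1.e\,\mathsf{then}\,C_1\,\mathsf{else}\,C_2]\!]_\ell$ is $\mathsf{if}\,e\,\mathsf{then}\,[\![C_1]\!]_\ell\,\mathsf{else}\,[\![C_2]\!]_\ell$ if $\ell=\ell_1$, else $[\![C_1]\!]_\ell\sqcup[\![C_2]\!]_\ell$;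 - $[\![\mathsf{let}\,\ell_1.x:=C_1\,\mathsf{in}\,C_2]\!]_\ell$ is $\mathsf{let}\,\mathsf{ret}(x)=[\![C_1]\!]_\ell\,\mathsf{in}\,[\![C_2]\!]_\ell$ if $\ell=\ell_1$, else $(\mathsf{fun}\,F(X):=[\![C_2]\!]_\ell)\,[\![C_1]\!]_\ell$ with $F,X$ fresh; - $[\![\mathsf{fun}_{\ell_1}\,F(x):=C]\!]_\ell$ is $\mathsf{fun}\,F(x):=[\![C]\!]_\ell$ if $\ell=\ell_1$, else $\mathsf{fun}\,F(X):=[\![C]\!]_\ell$ with $X$ fresh; $[\![\mathsf{fun}\,F(X):=C]\!]_\ell=\mathsf{fun}\,F(X):=[\![C]\!]_\ell$; - $[\![C\,(\ell_1.e)]\!]_\ell$ is $[\![C]\!]_\ell\,e$ if $\ell=\ell_1$, else $[\![C]\!]_\ell\,()$; $[\![C_1\,C_2]\!]_\ell=[\![C_1]\!]_\ell\,[\![C_2]\!]_\ell$. For a finite set $\mathfrak L$ of locations, $[\![C]\!]_{\mathfrak L}$ is the system with exactly the locations of $\mathfrak L$ that runs $[\![C]\!]_\ell$ at each $\ell\in\mathfrak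 L$; it is defined if all these projections are. *Statement.* Let $\Pi_1,\Pi_2$ be systems with the same set of locations and $\Pi_1\preceq\Pi_2$. Then: 1. If $\Pi_1\xrightarrow{L}\Pi_1'$, then there is a $\Pi_2'$ with $\Pi_1'\preceq\Pi_2'$ and $\Pi_2\xrightarrow{L}\Pi_2'$. 2. If $\Pi_2\xrightarrow{L}\Pi_2'$ and $\Pi_1=[\![C]\!]_{\mathfrak L}$ for some choreography $C$ and finite set $\mathfrak L$ of locations, then there is a $\Pi_1'$ with $\Pi_1'\preceq\Pi_2'$ and $\Pi_1\xrightarrow{L}\Pi_1'$. -/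

import Mathlib

universe u v

namespace Pirouette

/-- A local (message) language in nameless (de Bruijn) form: expressions with variables `var n`,
infinite parallel substitution, a closedness predicate (`ClosedBelow n e` says that every free
variable of `e` is smaller than `n`), closed values including two Booleans, and a small-step
semantics in which values do not step. -/
class LocalLang (Expr : Type v) where
  var : ℕ → Expr
  subst : Expr → (ℕ → Expr) → Expr
  ClosedBelow : ℕ → Expr → Prop
  IsValue : Expr → Prop
  tt : Expr
  ff : Expr
  Step : Expr → Expr → Prop
  subst_var : ∀ n σ, subst (var n) σ = σ n
  subst_id : ∀ e, subst e var = e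
  subst_subst : ∀ e σ₁ σ₂, subst (subst e σ₁) σ₂ = subst e (fun n => subst (σ₁ n) σ₂)
  closedBelow_var : ∀ n m, ClosedBelow n (var m) ↔ m < n
  subst_of_closedBelow : ∀ n e σ, ClosedBelow n e → (∀ m < n, σ m = var m) → subst e σ = e
  isValue_tt : IsValue tt
  isValue_ff : IsValue ff
  closed_of_isValue : ∀ e, IsValue e → ClosedBelow 0 e
  not_step_of_isValue : ∀ e₁ e₂, IsValue e₁ → ¬ Step e₁ e₂

/-- Synchronization labels. -/
inductive Choice where
  | left
  | right

/-! ### Choreographies -/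

/-- Choreographies, nameless. Every location has its own namespace of local variables:
`send ℓ₁ e ℓ₂ C` binds one local variable of `ℓ₂` in `C`; `defLocal ℓ C₁ C₂` binds one local
variable of `ℓ` in `C₂`; `funLocal ℓ C` binds one local variable of `ℓ` (the argument) and
choreography variable `0` (the function itself) in `C`; `funGlobal C` binds choreography variables
`0` (the argument) and `1` (the function itself) in `C`. -/
inductive Chor (Loc : Type u) (Expr : Type v) where
  | var (X : ℕ)
  | done (ℓ : Loc) (e : Expr)
  | send (ℓ₁ : Loc) (e : Expr) (ℓ₂ : Loc) (C : Chor Loc Expr)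
  | ite (ℓ : Loc) (e : Expr) (C₁ C₂ : Chor Loc Expr)
  | sync (ℓ₁ : Loc) (d : Choice) (ℓ₂ : Loc) (C : Chor Loc Expr)
  | defLocal (ℓ : Loc) (C₁ C₂ : Chor Loc Expr)
  | funLocal (ℓ : Loc) (C : Chor Loc Expr)
  | funGlobal (C : Chor Loc Expr)
  | appLocal (ℓ : Loc) (C : Chor Loc Expr) (e : Expr)
  | appGlobal (C₁ C₂ : Chor Loc Expr)

/-! ### The control language -/

/-- Control programs, nameless. `recv ℓ E` binds one local variable in `E`; `letRet E₁ E₂` binds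
one local variable in `E₂`; `funLocal E` binds one local variable (the argument) and control
variable `0` (the function itself) in `E`; `funGlobal E` binds control variables `0` (the
argument) and `1` (the function itself) in `E`. `allowL`, `allowR` and `allowLR` are external
choice with only the left, only the right, or both branches. -/
inductive Ctrl (Loc : Type u) (Expr : Type v) where
  | var (X : ℕ)
  | unit
  | ret (e : Expr)
  | ite (e : Expr) (E₁ E₂ : Ctrl Loc Expr)
  | send (e : Expr) (ℓ : Loc) (E : Ctrl Loc Expr)
  | recv (ℓ : Loc) (E : Ctrl Loc Expr)
  | choose (d : Choice) (ℓ : Loc) (E : Ctrl Loc Expr)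
  | allowL (ℓ : Loc) (E : Ctrl Loc Expr)
  | allowR (ℓ : Loc) (E : Ctrl Loc Expr)
  | allowLR (ℓ : Loc) (E₁ E₂ : Ctrl Loc Expr)
  | letRet (E₁ E₂ : Ctrl Loc Expr)
  | funLocal (E : Ctrl Loc Expr)
  | funGlobal (E : Ctrl Loc Expr)
  | appLocal (E : Ctrl Loc Expr) (e : Expr)
  | appGlobal (E₁ E₂ : Ctrl Loc Expr)

section Substitution

variable {Loc : Type u} {Expr : Type v}

/-- `a` for variable `0`, and `σ n` for variable `n + 1`. -/
def cons {α : Type*} (a : α) (σ : ℕ → α) : ℕ → α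
  | 0 => a
  | n + 1 => σ n

/-- A local substitution pushed under one local binder. -/
def upLocal [LocalLang Expr] (σ : ℕ → Expr) : ℕ → Expr :=
  cons (LocalLang.var 0)
    (fun n => LocalLang.subst (σ n) (fun k => LocalLang.var (k + 1)))

/-- Parallel substitution of local expressions for local variables. -/
def Ctrl.substLocal [LocalLang Expr] : Ctrl Loc Expr → (ℕ → Expr) → Ctrl Loc Expr
  | .var X, _ => .var X
  | .unit, _ => .unit
  | .ret e, σ => .ret (LocalLang.subst e σ)
  | .ite e E₁ E₂, σ => .ite (LocalLang.subst e σ) (E₁.substLocal σ) (E₂.substLocal σ)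
  | .send e ℓ E, σ => .send (LocalLang.subst e σ) ℓ (E.substLocal σ)
  | .recv ℓ E, σ => .recv ℓ (E.substLocal (upLocal σ))
  | .choose d ℓ E, σ => .choose d ℓ (E.substLocal σ)
  | .allowL ℓ E, σ => .allowL ℓ (E.substLocal σ)
  | .allowR ℓ E, σ => .allowR ℓ (E.substLocal σ)
  | .allowLR ℓ E₁ E₂, σ => .allowLR ℓ (E₁.substLocal σ) (E₂.substLocal σ)
  | .letRet E₁ E₂, σ => .letRet (E₁.substLocal σ) (E₂.substLocal (upLocal σ))
  | .funLocal E, σ => .funLocal (E.substLocal (upLocal σ))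
  | .funGlobal E, σ => .funGlobal (E.substLocal σ)
  | .appLocal E e, σ => .appLocal (E.substLocal σ) (LocalLang.subst e σ)
  | .appGlobal E₁ E₂, σ => .appGlobal (E₁.substLocal σ) (E₂.substLocal σ)

/-- A renaming pushed under one binder. -/
def upRen (ξ : ℕ → ℕ) : ℕ → ℕ := cons 0 (fun n => ξ n + 1)

/-- Renaming of control variables. -/
def Ctrl.rename : Ctrl Loc Expr → (ℕ → ℕ) → Ctrl Loc Expr
  | .var X, ξ => .var (ξ X)
  | .unit, _ => .unit
  | .ret e, _ => .ret e
  | .ite e E₁ E₂, ξ => .ite e (E₁.rename ξ) (E₂.rename ξ)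
  | .send e ℓ E, ξ => .send e ℓ (E.rename ξ)
  | .recv ℓ E, ξ => .recv ℓ (E.rename ξ)
  | .choose d ℓ E, ξ => .choose d ℓ (E.rename ξ)
  | .allowL ℓ E, ξ => .allowL ℓ (E.rename ξ)
  | .allowR ℓ E, ξ => .allowR ℓ (E.rename ξ)
  | .allowLR ℓ E₁ E₂, ξ => .allowLR ℓ (E₁.rename ξ) (E₂.rename ξ)
  | .letRet E₁ E₂, ξ => .letRet (E₁.rename ξ) (E₂.rename ξ)
  | .funLocal E, ξ => .funLocal (E.rename (upRen ξ))
  | .funGlobal E, ξ => .funGlobal (E.rename (upRen (upRen ξ)))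
  | .appLocal E e, ξ => .appLocal (E.rename ξ) e
  | .appGlobal E₁ E₂, ξ => .appGlobal (E₁.rename ξ) (E₂.rename ξ)

/-- A control substitution pushed under one control binder. -/
def upCtrl (τ : ℕ → Ctrl Loc Expr) : ℕ → Ctrl Loc Expr :=
  cons (.var 0) (fun n => (τ n).rename (fun k => k + 1))

/-- A control substitution pushed under one local binder. -/
def shiftLocal [LocalLang Expr] (τ : ℕ → Ctrl Loc Expr) : ℕ → Ctrl Loc Expr :=
  fun n => (τ n).substLocal (fun k => LocalLang.var (k + 1))

/-- Parallel substitution of control programs for control variables. -/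
def Ctrl.subst [LocalLang Expr] : Ctrl Loc Expr → (ℕ → Ctrl Loc Expr) → Ctrl Loc Expr
  | .var X, τ => τ X
  | .unit, _ => .unit
  | .ret e, _ => .ret e
  | .ite e E₁ E₂, τ => .ite e (E₁.subst τ) (E₂.subst τ)
  | .send e ℓ E, τ => .send e ℓ (E.subst τ)
  | .recv ℓ E, τ => .recv ℓ (E.subst (shiftLocal τ))
  | .choose d ℓ E, τ => .choose d ℓ (E.subst τ)
  | .allowL ℓ E, τ => .allowL ℓ (E.subst τ)
  | .allowR ℓ E, τ => .allowR ℓ (E.subst τ)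
  | .allowLR ℓ E₁ E₂, τ => .allowLR ℓ (E₁.subst τ) (E₂.subst τ)
  | .letRet E₁ E₂, τ => .letRet (E₁.subst τ) (E₂.subst (shiftLocal τ))
  | .funLocal E, τ => .funLocal (E.subst (upCtrl (shiftLocal τ)))
  | .funGlobal E, τ => .funGlobal (E.subst (upCtrl (upCtrl τ)))
  | .appLocal E e, τ => .appLocal (E.subst τ) e
  | .appGlobal E₁ E₂, τ => .appGlobal (E₁.subst τ) (E₂.subst τ)

/-- `E.inst v` replaces local variable `0` of `E` by `v`. -/
def Ctrl.inst [LocalLang Expr] (E : Ctrl Loc Expr) (v : Expr) : Ctrl Loc Expr :=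
  E.substLocal (cons v LocalLang.var)

/-- `E.ClosedBelow m n`: every free control variable of `E` is smaller than `m`, and every free
local variable of `E` is smaller than `n`. -/
def Ctrl.ClosedBelow [LocalLang Expr] : Ctrl Loc Expr → ℕ → ℕ → Prop
  | .var X, m, _ => X < m
  | .unit, _, _ => True
  | .ret e, _, n => LocalLang.ClosedBelow n e
  | .ite e E₁ E₂, m, n => LocalLang.ClosedBelow n e ∧ E₁.ClosedBelow m n ∧ E₂.ClosedBelow m n
  | .send e _ E, m, n => LocalLang.ClosedBelow n e ∧ E.ClosedBelow m n
  | .recv _ E, m, n => E.ClosedBelow m (n + 1)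
  | .choose _ _ E, m, n => E.ClosedBelow m n
  | .allowL _ E, m, n => E.ClosedBelow m n
  | .allowR _ E, m, n => E.ClosedBelow m n
  | .allowLR _ E₁ E₂, m, n => E₁.ClosedBelow m n ∧ E₂.ClosedBelow m n
  | .letRet E₁ E₂, m, n => E₁.ClosedBelow m n ∧ E₂.ClosedBelow m (n + 1)
  | .funLocal E, m, n => E.ClosedBelow (m + 1) (n + 1)
  | .funGlobal E, m, n => E.ClosedBelow (m + 2) n
  | .appLocal E e, m, n => E.ClosedBelow m n ∧ LocalLang.ClosedBelow n e
  | .appGlobal E₁ E₂, m, n => E₁.ClosedBelow m n ∧ E₂.ClosedBelow m n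

end Substitution

/-- Control-language values: `unit`, returned local values, and closed functions. -/
inductive Ctrl.IsValue {Loc : Type u} {Expr : Type v} [LocalLang Expr] : Ctrl Loc Expr → Prop
  | unit : IsValue .unit
  | ret {e : Expr} : LocalLang.IsValue e → IsValue (.ret e)
  | funLocal {E : Ctrl Loc Expr} : (Ctrl.funLocal E).ClosedBelow 0 0 → IsValue (.funLocal E)
  | funGlobal {E : Ctrl Loc Expr} : (Ctrl.funGlobal E).ClosedBelow 0 0 → IsValue (.funGlobal E)

/-- Labels of control-program steps; `tau` is the internal label (of a single location) and
`syncTau` the synchronized internal label. -/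
inductive Label (Loc : Type u) (Expr : Type v) where
  | tau
  | send (v : Expr) (ℓ : Loc)
  | recv (ℓ : Loc) (v : Expr)
  | choose (d : Choice) (ℓ : Loc)
  | allow (ℓ : Loc) (d : Choice)
  | syncTau
  | inFun (l : Label Loc Expr)
  | inArg (l : Label Loc Expr)

/-- The labelled transition system of control programs. -/
inductive Ctrl.Step {Loc : Type u} {Expr : Type v} [LocalLang Expr] :
    Label Loc Expr → Ctrl Loc Expr → Ctrl Loc Expr → Prop
  | retE {e₁ e₂ : Expr} : LocalLang.Step e₁ e₂ → Step .tau (.ret e₁) (.ret e₂)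
  | iteE {e₁ e₂ : Expr} {E₁ E₂ : Ctrl Loc Expr} : LocalLang.Step e₁ e₂ →
      Step .tau (.ite e₁ E₁ E₂) (.ite e₂ E₁ E₂)
  | iteTrue {E₁ E₂ : Ctrl Loc Expr} : Step .tau (.ite LocalLang.tt E₁ E₂) E₁
  | iteFalse {E₁ E₂ : Ctrl Loc Expr} : Step .tau (.ite LocalLang.ff E₁ E₂) E₂
  | sendE {e₁ e₂ : Expr} {ℓ : Loc} {E : Ctrl Loc Expr} : LocalLang.Step e₁ e₂ →
      Step .tau (.send e₁ ℓ E) (.send e₂ ℓ E)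
  | sendV {v : Expr} {ℓ : Loc} {E : Ctrl Loc Expr} : LocalLang.IsValue v →
      Step (.send v ℓ) (.send v ℓ E) E
  | recvV {v : Expr} {ℓ : Loc} {E : Ctrl Loc Expr} : LocalLang.IsValue v →
      Step (.recv ℓ v) (.recv ℓ E) (E.inst v)
  | choose {d : Choice} {ℓ : Loc} {E : Ctrl Loc Expr} : Step (.choose d ℓ) (.choose d ℓ E) E
  | allowL {ℓ : Loc} {E : Ctrl Loc Expr} : Step (.allow ℓ .left) (.allowL ℓ E) E
  | allowR {ℓ : Loc} {E : Ctrl Loc Expr} : Step (.allow ℓ .right) (.allowR ℓ E) E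
  | allowLRLeft {ℓ : Loc} {E₁ E₂ : Ctrl Loc Expr} :
      Step (.allow ℓ .left) (.allowLR ℓ E₁ E₂) E₁
  | allowLRRight {ℓ : Loc} {E₁ E₂ : Ctrl Loc Expr} :
      Step (.allow ℓ .right) (.allowLR ℓ E₁ E₂) E₂
  | letRetArg {l : Label Loc Expr} {E₁ E₁' E₂ : Ctrl Loc Expr} : Step l E₁ E₁' →
      Step (.inArg l) (.letRet E₁ E₂) (.letRet E₁' E₂)
  | letRet {v : Expr} {E : Ctrl Loc Expr} : LocalLang.IsValue v →
      Step .syncTau (.letRet (.ret v) E) (E.inst v)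
  | appLocalFun {l : Label Loc Expr} {E₁ E₂ : Ctrl Loc Expr} {e : Expr} : Step l E₁ E₂ →
      Step (.inFun l) (.appLocal E₁ e) (.appLocal E₂ e)
  | appLocalArg {e₁ e₂ : Expr} {E : Ctrl Loc Expr} : LocalLang.Step e₁ e₂ →
      Step .tau (.appLocal E e₁) (.appLocal E e₂)
  | appLocal {v : Expr} {E : Ctrl Loc Expr} : LocalLang.IsValue v →
      Step .syncTau (.appLocal (.funLocal E) v)
        ((E.inst v).subst (cons (.funLocal E) .var))
  | appGlobalFun {l : Label Loc Expr} {E₁ E₂ A : Ctrl Loc Expr} : Step l E₁ E₂ →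
      Step (.inFun l) (.appGlobal E₁ A) (.appGlobal E₂ A)
  | appGlobalArg {l : Label Loc Expr} {E A₁ A₂ : Ctrl Loc Expr} : Step l A₁ A₂ →
      Step (.inArg l) (.appGlobal E A₁) (.appGlobal E A₂)
  | appGlobal {E V : Ctrl Loc Expr} : V.IsValue →
      Step .syncTau (.appGlobal (.funGlobal E) V)
        (E.subst (cons V (cons (.funGlobal E) .var)))

/-- `LND E₁ E₂`: the program `E₁` is less nondeterministic than `E₂`. -/
inductive Ctrl.LND {Loc : Type u} {Expr : Type v} : Ctrl Loc Expr → Ctrl Loc Expr → Prop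
  | var {X : ℕ} : LND (.var X) (.var X)
  | unit : LND .unit .unit
  | ret {e : Expr} : LND (.ret e) (.ret e)
  | ite {e : Expr} {E₁₁ E₁₂ E₂₁ E₂₂ : Ctrl Loc Expr} : LND E₁₁ E₂₁ → LND E₁₂ E₂₂ →
      LND (.ite e E₁₁ E₁₂) (.ite e E₂₁ E₂₂)
  | send {e : Expr} {ℓ : Loc} {E₁ E₂ : Ctrl Loc Expr} : LND E₁ E₂ →
      LND (.send e ℓ E₁) (.send e ℓ E₂)
  | recv {ℓ : Loc} {E₁ E₂ : Ctrl Loc Expr} : LND E₁ E₂ → LND (.recv ℓ E₁) (.recv ℓ E₂)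
  | choose {d : Choice} {ℓ : Loc} {E₁ E₂ : Ctrl Loc Expr} : LND E₁ E₂ →
      LND (.choose d ℓ E₁) (.choose d ℓ E₂)
  | allowL {ℓ : Loc} {E₁ E₂ : Ctrl Loc Expr} : LND E₁ E₂ → LND (.allowL ℓ E₁) (.allowL ℓ E₂)
  | allowL_allowLR {ℓ : Loc} {E₁ E₂₁ E₂₂ : Ctrl Loc Expr} : LND E₁ E₂₁ →
      LND (.allowL ℓ E₁) (.allowLR ℓ E₂₁ E₂₂)
  | allowR {ℓ : Loc} {E₁ E₂ : Ctrl Loc Expr} : LND E₁ E₂ → LND (.allowR ℓ E₁) (.allowR ℓ E₂)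
  | allowR_allowLR {ℓ : Loc} {E₁ E₂₁ E₂₂ : Ctrl Loc Expr} : LND E₁ E₂₂ →
      LND (.allowR ℓ E₁) (.allowLR ℓ E₂₁ E₂₂)
  | allowLR {ℓ : Loc} {E₁₁ E₁₂ E₂₁ E₂₂ : Ctrl Loc Expr} : LND E₁₁ E₂₁ → LND E₁₂ E₂₂ →
      LND (.allowLR ℓ E₁₁ E₁₂) (.allowLR ℓ E₂₁ E₂₂)
  | letRet {E₁₁ E₁₂ E₂₁ E₂₂ : Ctrl Loc Expr} : LND E₁₁ E₂₁ → LND E₁₂ E₂₂ →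
      LND (.letRet E₁₁ E₁₂) (.letRet E₂₁ E₂₂)
  | funLocal {E : Ctrl Loc Expr} : LND (.funLocal E) (.funLocal E)
  | appLocal {E₁ E₂ : Ctrl Loc Expr} {e : Expr} : LND E₁ E₂ →
      LND (.appLocal E₁ e) (.appLocal E₂ e)
  | funGlobal {E : Ctrl Loc Expr} : LND (.funGlobal E) (.funGlobal E)
  | appGlobal {E₁₁ E₁₂ E₂₁ E₂₂ : Ctrl Loc Expr} : LND E₁₁ E₂₁ → LND E₁₂ E₂₂ →
      LND (.appGlobal E₁₁ E₁₂) (.appGlobal E₂₁ E₂₂)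

/-! ### Merging and endpoint projection -/

open Classical in
/-- The partial merge operator on control programs; `none` means undefined. -/
noncomputable def Ctrl.merge {Loc : Type u} {Expr : Type v} :
    Ctrl Loc Expr → Ctrl Loc Expr → Option (Ctrl Loc Expr)
  | .var X, .var Y => if X = Y then some (.var X) else none
  | .unit, .unit => some .unit
  | .ret e, .ret e' => if e = e' then some (.ret e) else none
  | .ite e E₁₁ E₁₂, .ite e' E₂₁ E₂₂ =>
      if e = e' then do return .ite e (← merge E₁₁ E₂₁) (← merge E₁₂ E₂₂) else none
  | .send e ℓ E₁, .send e' ℓ' E₂ =>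
      if e = e' ∧ ℓ = ℓ' then do return .send e ℓ (← merge E₁ E₂) else none
  | .recv ℓ E₁, .recv ℓ' E₂ =>
      if ℓ = ℓ' then do return .recv ℓ (← merge E₁ E₂) else none
  | .choose d ℓ E₁, .choose d' ℓ' E₂ =>
      if d = d' ∧ ℓ = ℓ' then do return .choose d ℓ (← merge E₁ E₂) else none
  | .allowL ℓ E₁, .allowL ℓ' E₂ =>
      if ℓ = ℓ' then do return .allowL ℓ (← merge E₁ E₂) else none
  | .allowL ℓ E₁, .allowR ℓ' E₂ =>
      if ℓ = ℓ' then some (.allowLR ℓ E₁ E₂) else none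
  | .allowL ℓ E₁, .allowLR ℓ' E₂₁ E₂₂ =>
      if ℓ = ℓ' then do return .allowLR ℓ (← merge E₁ E₂₁) E₂₂ else none
  | .allowR ℓ E₁, .allowL ℓ' E₂ =>
      if ℓ = ℓ' then some (.allowLR ℓ E₂ E₁) else none
  | .allowR ℓ E₁, .allowR ℓ' E₂ =>
      if ℓ = ℓ' then do return .allowR ℓ (← merge E₁ E₂) else none
  | .allowR ℓ E₁, .allowLR ℓ' E₂₁ E₂₂ =>
      if ℓ = ℓ' then do return .allowLR ℓ E₂₁ (← merge E₁ E₂₂) else none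
  | .allowLR ℓ E₁₁ E₁₂, .allowL ℓ' E₂ =>
      if ℓ = ℓ' then do return .allowLR ℓ (← merge E₁₁ E₂) E₁₂ else none
  | .allowLR ℓ E₁₁ E₁₂, .allowR ℓ' E₂ =>
      if ℓ = ℓ' then do return .allowLR ℓ E₁₁ (← merge E₁₂ E₂) else none
  | .allowLR ℓ E₁₁ E₁₂, .allowLR ℓ' E₂₁ E₂₂ =>
      if ℓ = ℓ' then do return .allowLR ℓ (← merge E₁₁ E₂₁) (← merge E₁₂ E₂₂) else none
  | .letRet E₁₁ E₁₂, .letRet E₂₁ E₂₂ =>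
      do return .letRet (← merge E₁₁ E₂₁) (← merge E₁₂ E₂₂)
  | .funLocal E₁, .funLocal E₂ => if E₁ = E₂ then some (.funLocal E₁) else none
  | .funGlobal E₁, .funGlobal E₂ => if E₁ = E₂ then some (.funGlobal E₁) else none
  | .appLocal E₁ e, .appLocal E₂ e' =>
      if e = e' then do return .appLocal (← merge E₁ E₂) e else none
  | .appGlobal E₁₁ E₁₂, .appGlobal E₂₁ E₂₂ =>
      do return .appGlobal (← merge E₁₁ E₂₁) (← merge E₁₂ E₂₂)
  | _, _ => none

open Classical in
/-- Endpoint projection of a choreography to a location; `none` means undefined. The renamings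
make room for the fresh variables that are bound in functions but not in the choreography. -/
noncomputable def Chor.proj {Loc : Type u} {Expr : Type v} :
    Chor Loc Expr → Loc → Option (Ctrl Loc Expr)
  | .var X, _ => some (.var X)
  | .done ℓ₁ e, ℓ => if ℓ₁ = ℓ then some (.ret e) else some .unit
  | .send ℓ₁ e ℓ₂ C, ℓ =>
      if ℓ₁ = ℓ then
        if ℓ₂ = ℓ then none else do return .send e ℓ₂ (← proj C ℓ)
      else if ℓ₂ = ℓ then do return .recv ℓ₁ (← proj C ℓ)
      else proj C ℓ
  | .ite ℓ₁ e C₁ C₂, ℓ =>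
      if ℓ₁ = ℓ then do return .ite e (← proj C₁ ℓ) (← proj C₂ ℓ)
      else do Ctrl.merge (← proj C₁ ℓ) (← proj C₂ ℓ)
  | .sync ℓ₁ d ℓ₂ C, ℓ =>
      if ℓ₁ = ℓ then
        if ℓ₂ = ℓ then none else do return .choose d ℓ₂ (← proj C ℓ)
      else if ℓ₂ = ℓ then
        match d with
        | .left => do return .allowL ℓ₁ (← proj C ℓ)
        | .right => do return .allowR ℓ₁ (← proj C ℓ)
      else proj C ℓ
  | .defLocal ℓ₁ C₁ C₂, ℓ =>
      if ℓ₁ = ℓ then do return .letRet (← proj C₁ ℓ) (← proj C₂ ℓ)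
      else do
        return .appGlobal (.funGlobal ((← proj C₂ ℓ).rename (fun X => X + 2))) (← proj C₁ ℓ)
  | .funLocal ℓ₁ C, ℓ =>
      if ℓ₁ = ℓ then do return .funLocal (← proj C ℓ)
      else do return .funGlobal ((← proj C ℓ).rename (fun X => X + 1))
  | .funGlobal C, ℓ => do return .funGlobal (← proj C ℓ)
  | .appLocal ℓ₁ C e, ℓ =>
      if ℓ₁ = ℓ then do return .appLocal (← proj C ℓ) e
      else do return .appGlobal (← proj C ℓ) .unit
  | .appGlobal C₁ C₂, ℓ => do return .appGlobal (← proj C₁ ℓ) (← proj C₂ ℓ)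

/-! ### Systems -/

/-- A system: a finite parallel composition of control programs at distinct locations, given by
its lookup function, which is `none` at the locations that do not occur in the system. -/
@[ext]
structure System (Loc : Type u) (Expr : Type v) where
  lookup : Loc → Option (Ctrl Loc Expr)
  finite_locs : {ℓ | lookup ℓ ≠ none}.Finite

/-- The set of locations of a system. -/
def System.locs {Loc : Type u} {Expr : Type v} (S : System Loc Expr) : Set Loc :=
  {ℓ | S.lookup ℓ ≠ none}

open Classical in
/-- The system `S` with the program at `ℓ` (if there is one) replaced by `E`. -/
noncomputable def System.update {Loc : Type u} {Expr : Type v} (S : System Loc Expr) (ℓ : Loc)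
    (E : Ctrl Loc Expr) : System Loc Expr where
  lookup ℓ' := if ℓ' = ℓ then (S.lookup ℓ').map (fun _ => E) else S.lookup ℓ'
  finite_locs := S.finite_locs.subset fun ℓ' h h0 => h (by simp [h0])

/-- System labels; `tau` is internal and `syncTau` is synchronized internal. -/
inductive SysLabel (Loc : Type u) (Expr : Type v) where
  | tau
  | comm (ℓ₁ : Loc) (v : Expr) (ℓ₂ : Loc)
  | choice (ℓ₁ : Loc) (d : Choice) (ℓ₂ : Loc)
  | syncTau

/-- Merging of two control-program labels into a system label. -/
inductive LabelMerge {Loc : Type u} {Expr : Type v} :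
    Label Loc Expr → Label Loc Expr → SysLabel Loc Expr → Prop
  | tau : LabelMerge .tau .tau .tau
  | syncTau : LabelMerge .syncTau .syncTau .syncTau
  | comm {ℓ₁ ℓ₂ : Loc} {v : Expr} : LabelMerge (.send v ℓ₂) (.recv ℓ₁ v) (.comm ℓ₁ v ℓ₂)
  | choice {ℓ₁ ℓ₂ : Loc} {d : Choice} :
      LabelMerge (.choose d ℓ₂) (.allow ℓ₁ d) (.choice ℓ₁ d ℓ₂)
  | inFun {l₁ l₂ : Label Loc Expr} {L : SysLabel Loc Expr} : LabelMerge l₁ l₂ L →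
      LabelMerge (.inFun l₁) (.inFun l₂) L
  | inArg {l₁ l₂ : Label Loc Expr} {L : SysLabel Loc Expr} : LabelMerge l₁ l₂ L →
      LabelMerge (.inArg l₁) (.inArg l₂) L

/-- The labelled transition system of systems. -/
inductive System.Step {Loc : Type u} {Expr : Type v} [LocalLang Expr] :
    SysLabel Loc Expr → System Loc Expr → System Loc Expr → Prop
  | internal {S : System Loc Expr} {ℓ : Loc} {l : Label Loc Expr} {E E' : Ctrl Loc Expr} :
      LabelMerge l l .tau → S.lookup ℓ = some E → Ctrl.Step l E E' →
      Step .tau S (S.update ℓ E')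
  | syncInternal {S S' : System Loc Expr} {l : Label Loc Expr} :
      LabelMerge l l .syncTau → S'.locs = S.locs →
      (∀ ℓ E E', S.lookup ℓ = some E → S'.lookup ℓ = some E' → Ctrl.Step l E E') →
      Step .syncTau S S'
  | comm {S : System Loc Expr} {ℓ₁ ℓ₂ : Loc} {v : Expr} {l₁ l₂ : Label Loc Expr}
      {E₁ E₁' E₂ E₂' : Ctrl Loc Expr} :
      ℓ₁ ≠ ℓ₂ → LabelMerge l₁ l₂ (.comm ℓ₁ v ℓ₂) →
      S.lookup ℓ₁ = some E₁ → Ctrl.Step l₁ E₁ E₁' →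
      S.lookup ℓ₂ = some E₂ → Ctrl.Step l₂ E₂ E₂' →
      Step (.comm ℓ₁ v ℓ₂) S ((S.update ℓ₁ E₁').update ℓ₂ E₂')
  | choice {S : System Loc Expr} {ℓ₁ ℓ₂ : Loc} {d : Choice} {l₁ l₂ : Label Loc Expr}
      {E₁ E₁' E₂ E₂' : Ctrl Loc Expr} :
      ℓ₁ ≠ ℓ₂ → LabelMerge l₁ l₂ (.choice ℓ₁ d ℓ₂) →
      S.lookup ℓ₁ = some E₁ → Ctrl.Step l₁ E₁ E₁' →
      S.lookup ℓ₂ = some E₂ → Ctrl.Step l₂ E₂ E₂' →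
      Step (.choice ℓ₁ d ℓ₂) S ((S.update ℓ₁ E₁').update ℓ₂ E₂')

/-- The pointwise extension of the less-nondeterminism relation to systems. -/
def System.LND {Loc : Type u} {Expr : Type v} (S₁ S₂ : System Loc Expr) : Prop :=
  ∀ ℓ E₁, S₁.lookup ℓ = some E₁ → ∃ E₂, S₂.lookup ℓ = some E₂ ∧ Ctrl.LND E₁ E₂

open Classical in
/-- Projection of a choreography to a finite set `𝔏` of locations: the system that runs
`C.proj ℓ` at every `ℓ ∈ 𝔏`, defined (not `none`) if all these projections are. -/
noncomputable def Chor.projSystem {Loc : Type u} {Expr : Type v} (C : Chor Loc Expr)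
    (𝔏 : Finset Loc) : Option (System Loc Expr) :=
  if ∀ ℓ ∈ 𝔏, C.proj ℓ ≠ none then
    some
      { lookup := fun ℓ => if ℓ ∈ 𝔏 then C.proj ℓ else none
        finite_locs := 𝔏.finite_toSet.subset fun ℓ h => by
          by_contra h0
          exact h (if_neg h0) }
  else none

end Pirouette

namespace Pirouette

variable {Loc : Type u} {Expr : Type v}

/-! ### Basic properties of the less-nondeterminism relation -/

/-! Passing from `E₁` to a more nondeterministic `E₂` only adds branches to external choices, and
functions are related only to themselves. So every step of `E₁` is still available to `E₂`
(`Ctrl.Step.lift`). The function and argument of a redex agree on both sides, hence control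
substitution never has to be compared; only local substitution does (`Ctrl.LND.substLocal`).

In the other direction a single program can fail in one way only: the step selects a branch that
`E₁` lacks, and then `E₁` is waiting, in the same evaluation context, with the other branch
(`Ctrl.Step.lower`). Internal steps, synchronized steps and messages select no branch, so only
choice communications remain. For arbitrary systems these do break: a sender choosing left may face
a receiver that offers only right, while the larger system offers both.

Projection excludes this (`Chor.can_allow_of_can_choose`). The projections of one choreography share
the nesting of applications and lets that `inFun` and `inArg` record. If, in the same context, `ℓ₁`
can choose `d` for `ℓ₂` and `ℓ₂` awaits a choice from `ℓ₁`, then both actions come from the same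
`sync` node, whose projection to `ℓ₂` offers `d`. Conditionals of third parties are handled by
passing from the merge to one branch and back along the less-nondeterminism relation. -/

theorem Ctrl.LND.refl (E : Ctrl Loc Expr) : Ctrl.LND E E := by
  induction E <;> constructor <;> assumption

theorem Ctrl.LND.substLocal [LocalLang Expr] {E₁ E₂ : Ctrl Loc Expr} (h : Ctrl.LND E₁ E₂)
    (σ : ℕ → Expr) : Ctrl.LND (E₁.substLocal σ) (E₂.substLocal σ) := by
  induction h generalizing σ with
  | var => exact .var
  | unit => exact .unit
  | ret => exact .ret
  | ite _ _ ih₁ ih₂ => exact .ite (ih₁ _) (ih₂ _)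
  | send _ ih => exact .send (ih _)
  | recv _ ih => exact .recv (ih _)
  | choose _ ih => exact .choose (ih _)
  | allowL _ ih => exact .allowL (ih _)
  | allowL_allowLR _ ih => exact .allowL_allowLR (ih _)
  | allowR _ ih => exact .allowR (ih _)
  | allowR_allowLR _ ih => exact .allowR_allowLR (ih _)
  | allowLR _ _ ih₁ ih₂ => exact .allowLR (ih₁ _) (ih₂ _)
  | letRet _ _ ih₁ ih₂ => exact .letRet (ih₁ _) (ih₂ _)
  | funLocal => exact .funLocal
  | appLocal _ ih => exact .appLocal (ih _)
  | funGlobal => exact .funGlobal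
  | appGlobal _ _ ih₁ ih₂ => exact .appGlobal (ih₁ _) (ih₂ _)

theorem Ctrl.LND.inst [LocalLang Expr] {E₁ E₂ : Ctrl Loc Expr} (h : Ctrl.LND E₁ E₂)
    (v : Expr) : Ctrl.LND (E₁.inst v) (E₂.inst v) :=
  h.substLocal _

/-- The relation does not look inside functions, and the other values contain no control programs.
This and its mirror image make the arguments of a global beta step identical on both sides. -/
theorem Ctrl.LND.eq_of_isValue_left [LocalLang Expr] {V E : Ctrl Loc Expr}
    (h : Ctrl.LND V E) (hV : V.IsValue) : E = V := by
  cases hV <;> cases h <;> rfl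

theorem Ctrl.LND.eq_of_isValue_right [LocalLang Expr] {E V : Ctrl Loc Expr}
    (h : Ctrl.LND E V) (hV : V.IsValue) : E = V := by
  cases hV <;> cases h <;> rfl

/-- Both arguments of a merge are less nondeterministic than the result. -/
theorem Ctrl.lnd_of_merge {E₁ E₂ E : Ctrl Loc Expr} (h : Ctrl.merge E₁ E₂ = some E) :
    Ctrl.LND E₁ E ∧ Ctrl.LND E₂ E := by
  induction E₁, E₂ using Ctrl.merge.induct generalizing E <;>
    simp_all [Ctrl.merge, Option.bind_eq_some_iff]
  -- Variables, unit, returns and the two kinds of function merge only with themselves.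
  case case1 | case3 | case4 | case33 | case35 => exact .refl _
  -- A left-only and a right-only choice: each argument supplies one branch of the result unchanged.
  case case16 | case20 =>
    subst h
    constructor <;> constructor <;> exact .refl _
  -- The constructs with two recursive merges: conditionals, two-branch choices, lets and global
  -- applications.
  case case6 ih₁ ih₂ | case30 ih₁ ih₂ | case32 ih₁ ih₂ | case39 ih₁ ih₂ =>
    obtain ⟨_, h₁, _, h₂, rfl⟩ := h
    obtain ⟨a₁, b₁⟩ := ih₁ h₁
    obtain ⟨a₂, b₂⟩ := ih₂ h₂
    constructor <;> constructor <;> assumption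
  -- One recursive merge; when a one-branch choice meets a two-branch one, the branch not merged is
  -- copied, which reflexivity covers.
  all_goals
    rename_i ih
    obtain ⟨_, h, rfl⟩ := h
    obtain ⟨a, b⟩ := ih h
    constructor <;> constructor <;> first | assumption | exact .refl _

/-! ### Lifting and lowering control-program steps -/

/-- A control program that steps can be matched by every more nondeterministic one. -/
theorem Ctrl.Step.lift [LocalLang Expr] {l : Label Loc Expr} {E₁ E₁' E₂ : Ctrl Loc Expr}
    (hs : Ctrl.Step l E₁ E₁') (h : Ctrl.LND E₁ E₂) :
    ∃ E₂', Ctrl.LND E₁' E₂' ∧ Ctrl.Step l E₂ E₂' := by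
  induction hs generalizing E₂ with
  | retE s => cases h; exact ⟨_, .refl _, .retE s⟩
  | iteE s => cases h with | ite h₁ h₂ => exact ⟨_, .ite h₁ h₂, .iteE s⟩
  | iteTrue => cases h with | ite h₁ h₂ => exact ⟨_, h₁, .iteTrue⟩
  | iteFalse => cases h with | ite h₁ h₂ => exact ⟨_, h₂, .iteFalse⟩
  | sendE s => cases h with | send h => exact ⟨_, .send h, .sendE s⟩
  | sendV hv => cases h with | send h => exact ⟨_, h, .sendV hv⟩
  | recvV hv => cases h with | recv h => exact ⟨_, h.inst _, .recvV hv⟩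
  | choose => cases h with | choose h => exact ⟨_, h, .choose⟩
  | allowL =>
    cases h with
    | allowL h => exact ⟨_, h, .allowL⟩
    | allowL_allowLR h => exact ⟨_, h, .allowLRLeft⟩
  | allowR =>
    cases h with
    | allowR h => exact ⟨_, h, .allowR⟩
    | allowR_allowLR h => exact ⟨_, h, .allowLRRight⟩
  | allowLRLeft => cases h with | allowLR h₁ h₂ => exact ⟨_, h₁, .allowLRLeft⟩
  | allowLRRight => cases h with | allowLR h₁ h₂ => exact ⟨_, h₂, .allowLRRight⟩
  | letRetArg s ih =>
    cases h with
    | letRet h₁ h₂ =>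
      obtain ⟨E', h', s'⟩ := ih h₁
      exact ⟨_, .letRet h' h₂, .letRetArg s'⟩
  | letRet hv =>
    cases h with
    -- Returned expressions are related only if equal, so the same value is substituted on both
    -- sides.
    | letRet h₁ h₂ => cases h₁; exact ⟨_, h₂.inst _, .letRet hv⟩
  | appLocalFun s ih =>
    cases h with
    | appLocal h =>
      obtain ⟨E', h', s'⟩ := ih h
      exact ⟨_, .appLocal h', .appLocalFun s'⟩
  | appLocalArg s => cases h with | appLocal h => exact ⟨_, .appLocal h, .appLocalArg s⟩
  | appLocal hv =>
    cases h with
    | appLocal h => cases h; exact ⟨_, .refl _, .appLocal hv⟩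
  | appGlobalFun s ih =>
    cases h with
    | appGlobal h₁ h₂ =>
      obtain ⟨E', h', s'⟩ := ih h₁
      exact ⟨_, .appGlobal h' h₂, .appGlobalFun s'⟩
  | appGlobalArg s ih =>
    cases h with
    | appGlobal h₁ h₂ =>
      obtain ⟨E', h', s'⟩ := ih h₂
      exact ⟨_, .appGlobal h₁ h', .appGlobalArg s'⟩
  | appGlobal hV =>
    cases h with
    | appGlobal h₁ h₂ =>
      cases h₁
      obtain rfl := h₂.eq_of_isValue_left hV
      exact ⟨_, .refl _, .appGlobal hV⟩

/-- The label `l` with the branch selected by an external choice, if it is one, set to `d`. -/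
def Label.setBranch (d : Choice) : Label Loc Expr → Label Loc Expr
  | .allow ℓ _ => .allow ℓ d
  | .inFun l => .inFun (l.setBranch d)
  | .inArg l => .inArg (l.setBranch d)
  | l => l

/-- `E.Can l`: the program `E` has a step with label `l`. -/
def Ctrl.Can [LocalLang Expr] (E : Ctrl Loc Expr) (l : Label Loc Expr) : Prop :=
  ∃ E', Ctrl.Step l E E'

theorem Ctrl.LND.can [LocalLang Expr] {l : Label Loc Expr} {E₁ E₂ : Ctrl Loc Expr}
    (h : Ctrl.LND E₁ E₂) (hs : E₁.Can l) : E₂.Can l := by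
  obtain ⟨_, s⟩ := hs
  obtain ⟨E', -, s'⟩ := s.lift h
  exact ⟨E', s'⟩

/-- This equivalence and the next three strip one evaluation context from both program and label.
Being equivalences, they transport the negative claim `¬ E₁.Can l` as well. -/
theorem Ctrl.can_inFun_appLocal [LocalLang Expr] {l : Label Loc Expr} {E : Ctrl Loc Expr}
    {e : Expr} : (Ctrl.appLocal E e).Can (.inFun l) ↔ E.Can l := by
  constructor
  · rintro ⟨_, s⟩
    cases s with | appLocalFun s => exact ⟨_, s⟩
  · rintro ⟨_, s⟩
    exact ⟨_, .appLocalFun s⟩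

theorem Ctrl.can_inFun_appGlobal [LocalLang Expr] {l : Label Loc Expr} {E A : Ctrl Loc Expr} :
    (Ctrl.appGlobal E A).Can (.inFun l) ↔ E.Can l := by
  constructor
  · rintro ⟨_, s⟩
    cases s with | appGlobalFun s => exact ⟨_, s⟩
  · rintro ⟨_, s⟩
    exact ⟨_, .appGlobalFun s⟩

theorem Ctrl.can_inArg_appGlobal [LocalLang Expr] {l : Label Loc Expr} {E A : Ctrl Loc Expr} :
    (Ctrl.appGlobal E A).Can (.inArg l) ↔ A.Can l := by
  constructor
  · rintro ⟨_, s⟩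
    cases s with | appGlobalArg s => exact ⟨_, s⟩
  · rintro ⟨_, s⟩
    exact ⟨_, .appGlobalArg s⟩

theorem Ctrl.can_inArg_letRet [LocalLang Expr] {l : Label Loc Expr} {E₁ E₂ : Ctrl Loc Expr} :
    (Ctrl.letRet E₁ E₂).Can (.inArg l) ↔ E₁.Can l := by
  constructor
  · rintro ⟨_, s⟩
    cases s with | letRetArg s => exact ⟨_, s⟩
  · rintro ⟨_, s⟩
    exact ⟨_, .letRetArg s⟩

/-- A step of a program can be matched by every less nondeterministic one, unless it selects a
branch that the latter does not offer. -/
theorem Ctrl.Step.lower [LocalLang Expr] {l : Label Loc Expr} {E₁ E₂ E₂' : Ctrl Loc Expr}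
    (hs : Ctrl.Step l E₂ E₂') (h : Ctrl.LND E₁ E₂) :
    (∃ E₁', Ctrl.LND E₁' E₂' ∧ Ctrl.Step l E₁ E₁') ∨
      ¬ E₁.Can l ∧ ∃ d, E₁.Can (l.setBranch d) := by
  induction hs generalizing E₁ with
  | retE s => cases h; exact .inl ⟨_, .refl _, .retE s⟩
  | iteE s => cases h with | ite h₁ h₂ => exact .inl ⟨_, .ite h₁ h₂, .iteE s⟩
  | iteTrue => cases h with | ite h₁ h₂ => exact .inl ⟨_, h₁, .iteTrue⟩
  | iteFalse => cases h with | ite h₁ h₂ => exact .inl ⟨_, h₂, .iteFalse⟩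
  | sendE s => cases h with | send h => exact .inl ⟨_, .send h, .sendE s⟩
  | sendV hv => cases h with | send h => exact .inl ⟨_, h, .sendV hv⟩
  | recvV hv => cases h with | recv h => exact .inl ⟨_, h.inst _, .recvV hv⟩
  | choose => cases h with | choose h => exact .inl ⟨_, h, .choose⟩
  | allowL => cases h with | allowL h => exact .inl ⟨_, h, .allowL⟩
  | allowR => cases h with | allowR h => exact .inl ⟨_, h, .allowR⟩
  | allowLRLeft =>
    cases h with
    | allowLR h₁ h₂ => exact .inl ⟨_, h₁, .allowLRLeft⟩
    | allowL_allowLR h => exact .inl ⟨_, h, .allowL⟩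
    -- The genuine failure: left is selected, but the smaller program offers only right.
    | allowR_allowLR h => exact .inr ⟨fun ⟨_, s⟩ => (nomatch s), .right, _, .allowR⟩
  | allowLRRight =>
    cases h with
    | allowLR h₁ h₂ => exact .inl ⟨_, h₂, .allowLRRight⟩
    | allowL_allowLR h => exact .inr ⟨fun ⟨_, s⟩ => (nomatch s), .left, _, .allowL⟩
    | allowR_allowLR h => exact .inl ⟨_, h, .allowR⟩
  | letRetArg s ih =>
    cases h with
    | letRet h₁ h₂ =>
      simp only [Label.setBranch, Ctrl.can_inArg_letRet]
      exact (ih h₁).imp_left fun ⟨_, h', s'⟩ => ⟨_, .letRet h' h₂, .letRetArg s'⟩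
  | letRet hv =>
    cases h with
    | letRet h₁ h₂ => cases h₁; exact .inl ⟨_, h₂.inst _, .letRet hv⟩
  | appLocalFun s ih =>
    cases h with
    | appLocal h =>
      simp only [Label.setBranch, Ctrl.can_inFun_appLocal]
      exact (ih h).imp_left fun ⟨_, h', s'⟩ => ⟨_, .appLocal h', .appLocalFun s'⟩
  | appLocalArg s => cases h with | appLocal h => exact .inl ⟨_, .appLocal h, .appLocalArg s⟩
  | appLocal hv =>
    cases h with
    | appLocal h => cases h; exact .inl ⟨_, .refl _, .appLocal hv⟩
  | appGlobalFun s ih =>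
    cases h with
    | appGlobal h₁ h₂ =>
      simp only [Label.setBranch, Ctrl.can_inFun_appGlobal]
      exact (ih h₁).imp_left fun ⟨_, h', s'⟩ => ⟨_, .appGlobal h' h₂, .appGlobalFun s'⟩
  | appGlobalArg s ih =>
    cases h with
    | appGlobal h₁ h₂ =>
      simp only [Label.setBranch, Ctrl.can_inArg_appGlobal]
      exact (ih h₂).imp_left fun ⟨_, h', s'⟩ => ⟨_, .appGlobal h₁ h', .appGlobalArg s'⟩
  | appGlobal hV =>
    cases h with
    | appGlobal h₁ h₂ =>
      cases h₁
      obtain rfl := h₂.eq_of_isValue_right hV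
      exact .inl ⟨_, .refl _, .appGlobal hV⟩

/-- A step whose label selects no branch is matched by every less nondeterministic program. -/
theorem Ctrl.Step.lower_of_setBranch_eq [LocalLang Expr] {l : Label Loc Expr}
    {E₁ E₂ E₂' : Ctrl Loc Expr} (hs : Ctrl.Step l E₂ E₂') (h : Ctrl.LND E₁ E₂)
    (hl : ∀ d, l.setBranch d = l) : ∃ E₁', Ctrl.LND E₁' E₂' ∧ Ctrl.Step l E₁ E₁' := by
  rcases hs.lower h with h | ⟨hn, d, hd⟩
  · exact h
  · rw [hl] at hd
    exact absurd hd hn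

theorem Label.setBranch_setBranch (d d' : Choice) (l : Label Loc Expr) :
    (l.setBranch d').setBranch d = l.setBranch d := by
  induction l <;> simp_all [Label.setBranch]

/-- If `E₂` offers some branch, so does every less nondeterministic `E₁`. -/
theorem Ctrl.LND.exists_can_setBranch [LocalLang Expr] {l : Label Loc Expr} {d : Choice}
    {E₁ E₂ : Ctrl Loc Expr} (h : Ctrl.LND E₁ E₂) (hs : E₂.Can (l.setBranch d)) :
    ∃ d', E₁.Can (l.setBranch d') := by
  obtain ⟨_, s⟩ := hs
  rcases s.lower h with ⟨_, -, s'⟩ | ⟨-, d', hd⟩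
  · exact ⟨d, _, s'⟩
  · exact ⟨d', by rwa [Label.setBranch_setBranch] at hd⟩

/-! ### Merging of labels -/

/-- Merging is oriented: `allow` occurs only on the right. Hence internal labels, which merge with
themselves, and all sender labels select no branch. -/
theorem LabelMerge.setBranch_left {l₁ l₂ : Label Loc Expr} {L : SysLabel Loc Expr}
    (h : LabelMerge l₁ l₂ L) (d : Choice) : l₁.setBranch d = l₁ := by
  induction h <;> simp_all [Label.setBranch]

theorem LabelMerge.setBranch_right_of_comm {l₁ l₂ : Label Loc Expr} {ℓ₁ ℓ₂ : Loc} {v : Expr}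
    (h : LabelMerge l₁ l₂ (.comm ℓ₁ v ℓ₂)) (d : Choice) : l₂.setBranch d = l₂ := by
  generalize hL : SysLabel.comm ℓ₁ v ℓ₂ = L at h
  induction h <;> simp_all [Label.setBranch]

/-! ### Projections agree on selected branches -/

/-- If the projection of `C` to `ℓ₁` can send a choice to `ℓ₂`, and the projection of `C` to `ℓ₂`
is ready to receive a choice from `ℓ₁` in the same context, then it offers the chosen branch. -/
theorem Chor.can_allow_of_can_choose [LocalLang Expr] {ℓ₁ ℓ₂ : Loc} (hne : ℓ₁ ≠ ℓ₂)
    {d d' : Choice} {l₁ l₂ : Label Loc Expr} (hl : LabelMerge l₁ l₂ (.choice ℓ₁ d ℓ₂))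
    {C : Chor Loc Expr} {E₁ E₂ : Ctrl Loc Expr} (h₁ : C.proj ℓ₁ = some E₁)
    (h₂ : C.proj ℓ₂ = some E₂) (hs₁ : E₁.Can l₁) (hs₂ : E₂.Can (l₂.setBranch d')) :
    E₂.Can l₂ := by
  -- `d'` must vary because descending into one branch of a merged conditional may change which
  -- branch is on offer; the labels vary because contexts are stripped.
  induction C generalizing d' l₁ l₂ E₁ E₂ with
  | var X =>
    obtain rfl := Option.some.inj h₁
    obtain ⟨_, s₁⟩ := hs₁
    cases s₁
  | done ℓ e =>
    simp only [Chor.proj] at h₁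
    obtain ⟨_, s₁⟩ := hs₁
    split_ifs at h₁ <;> obtain rfl := Option.some.inj h₁ <;> cases s₁
    cases hl
  | send ℓ e ℓ' C ih =>
    -- A location taking part in the message is blocked by it and can do nothing that belongs to a
    -- choice, so both projections must be those of the continuation.
    have key : ∀ {ℓ₀ : Loc} {E : Ctrl Loc Expr}, (Chor.send ℓ e ℓ' C).proj ℓ₀ = some E →
        ∃ P, C.proj ℓ₀ = some P ∧ (E = .send e ℓ' P ∨ E = .recv ℓ P ∨ E = P) := by
      intro ℓ₀ E hE
      simp only [Chor.proj] at hE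
      split_ifs at hE
      · obtain ⟨P, hP, hE⟩ := Option.bind_eq_some_iff.1 hE
        exact ⟨P, hP, .inl (Option.some.inj hE).symm⟩
      · obtain ⟨P, hP, hE⟩ := Option.bind_eq_some_iff.1 hE
        exact ⟨P, hP, .inr (.inl (Option.some.inj hE).symm)⟩
      · exact ⟨E, hE, .inr (.inr rfl)⟩
    obtain ⟨P₁, hP₁, rfl | rfl | rfl⟩ := key h₁
    · obtain ⟨_, s₁⟩ := hs₁
      cases s₁ <;> cases hl
    · obtain ⟨_, s₁⟩ := hs₁
      cases s₁ <;> cases hl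
    · obtain ⟨P₂, hP₂, rfl | rfl | rfl⟩ := key h₂
      · cases hl <;> obtain ⟨_, s₂⟩ := hs₂ <;> cases s₂
      · cases hl <;> obtain ⟨_, s₂⟩ := hs₂ <;> cases s₂
      · exact ih hl hP₁ hP₂ hs₁ hs₂
  | ite ℓ e C₁ C₂ ih₁ ih₂ =>
    by_cases h : ℓ = ℓ₁
    · simp [Chor.proj, h, Option.bind_eq_some_iff] at h₁
      obtain ⟨_, _, _, _, rfl⟩ := h₁
      obtain ⟨_, s₁⟩ := hs₁
      cases s₁ <;> cases hl
    · by_cases h' : ℓ = ℓ₂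
      · simp [Chor.proj, h', Option.bind_eq_some_iff] at h₂
        obtain ⟨_, _, _, _, rfl⟩ := h₂
        cases hl <;> obtain ⟨_, s₂⟩ := hs₂ <;> cases s₂
      · simp [Chor.proj, h, Option.bind_eq_some_iff] at h₁
        simp [Chor.proj, h', Option.bind_eq_some_iff] at h₂
        obtain ⟨P₁, hP₁, Q₁, hQ₁, hm₁⟩ := h₁
        obtain ⟨P₂, hP₂, Q₂, hQ₂, hm₂⟩ := h₂
        -- Neither party owns the conditional, so both programs are merges. Passing to `C₁` alone
        -- suffices: the sender's step and the receiver's readiness go down to it, and the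
        -- receiver's ability to take branch `d` goes back up.
        have hL₁ := (Ctrl.lnd_of_merge hm₁).1
        have hL₂ := (Ctrl.lnd_of_merge hm₂).1
        obtain ⟨_, s₁⟩ := hs₁
        obtain ⟨_, -, t₁⟩ := s₁.lower_of_setBranch_eq hL₁ hl.setBranch_left
        obtain ⟨_, hd⟩ := hL₂.exists_can_setBranch hs₂
        exact hL₂.can (ih₁ hl hP₁ hP₂ ⟨_, t₁⟩ hd)
  | sync ℓ d₀ ℓ' C ih =>
    by_cases h : ℓ = ℓ₁
    · subst h
      obtain ⟨_, s₁⟩ := hs₁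
      simp only [Chor.proj, if_true] at h₁
      split_ifs at h₁
      obtain ⟨P₁, -, hE₁⟩ := Option.bind_eq_some_iff.1 h₁
      obtain rfl := Option.some.inj hE₁
      -- The sender's only step is the choice of this node, which fixes the branch and the receiver;
      -- the projection to `ℓ₂` then offers exactly that branch.
      cases s₁
      cases hl
      simp only [Chor.proj, if_neg hne, if_true] at h₂
      cases d <;> obtain ⟨P₂, -, hE₂⟩ := Option.bind_eq_some_iff.1 h₂ <;>
        obtain rfl := Option.some.inj hE₂
      · exact ⟨_, .allowL⟩
      · exact ⟨_, .allowR⟩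
    · have key : ∀ {ℓ₀ : Loc} {E : Ctrl Loc Expr}, (Chor.sync ℓ d₀ ℓ' C).proj ℓ₀ = some E →
          ∃ P, C.proj ℓ₀ = some P ∧
            ((E = .choose d₀ ℓ' P ∧ ℓ = ℓ₀) ∨ E = .allowL ℓ P ∨ E = .allowR ℓ P ∨ E = P) := by
        intro ℓ₀ E hE
        simp only [Chor.proj] at hE
        split_ifs at hE with h₀
        · obtain ⟨P, hP, hE⟩ := Option.bind_eq_some_iff.1 hE
          exact ⟨P, hP, .inl ⟨(Option.some.inj hE).symm, h₀⟩⟩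
        · cases d₀ <;> obtain ⟨P, hP, hE⟩ := Option.bind_eq_some_iff.1 hE
          · exact ⟨P, hP, .inr (.inl (Option.some.inj hE).symm)⟩
          · exact ⟨P, hP, .inr (.inr (.inl (Option.some.inj hE).symm))⟩
        · exact ⟨E, hE, .inr (.inr (.inr rfl))⟩
      obtain ⟨P₁, hP₁, ⟨rfl, h'⟩ | rfl | rfl | rfl⟩ := key h₁
      · exact absurd h' h
      · obtain ⟨_, s₁⟩ := hs₁
        cases s₁
        cases hl
      · obtain ⟨_, s₁⟩ := hs₁
        cases s₁
        cases hl
      · obtain ⟨P₂, hP₂, ⟨rfl, -⟩ | rfl | rfl | rfl⟩ := key h₂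
        · cases hl <;> obtain ⟨_, s₂⟩ := hs₂ <;> cases s₂
        -- Here the receiver awaits `ℓ`, whereas its label names `ℓ₁`, and these differ.
        · cases hl <;> obtain ⟨_, s₂⟩ := hs₂ <;> cases s₂
          exact absurd rfl h
        · cases hl <;> obtain ⟨_, s₂⟩ := hs₂ <;> cases s₂
          exact absurd rfl h
        · exact ih hl hP₁ hP₂ hs₁ hs₂
  | defLocal ℓ C₁ C₂ ih₁ ih₂ =>
    -- At other locations a let becomes the application of a function. In both forms the projection
    -- of `C₁` runs under `inArg`, so the contexts of sender and receiver agree even when their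
    -- programs have different shapes.
    have key : ∀ {ℓ₀ : Loc} {E : Ctrl Loc Expr}, (Chor.defLocal ℓ C₁ C₂).proj ℓ₀ = some E →
        ∃ P Q, C₁.proj ℓ₀ = some P ∧ (E = .letRet P Q ∨ E = .appGlobal (.funGlobal Q) P) := by
      intro ℓ₀ E hE
      by_cases h : ℓ = ℓ₀ <;> simp [Chor.proj, h, Option.bind_eq_some_iff] at hE
      · obtain ⟨P, hP, Q, -, rfl⟩ := hE
        exact ⟨P, Q, hP, .inl rfl⟩
      · obtain ⟨Q, -, P, hP, rfl⟩ := hE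
        exact ⟨P, _, hP, .inr rfl⟩
    obtain ⟨P₁, Q₁, hP₁, hE₁⟩ := key h₁
    obtain ⟨P₂, Q₂, hP₂, hE₂⟩ := key h₂
    cases hl with
    | choice => obtain ⟨_, s₁⟩ := hs₁; obtain rfl | rfl := hE₁ <;> cases s₁
    | inFun hl =>
      obtain ⟨_, s₁⟩ := hs₁
      obtain rfl | rfl := hE₁
      · cases s₁
      · cases s₁ with | appGlobalFun s₁ => cases s₁
    | inArg hl =>
      obtain rfl | rfl := hE₁ <;> obtain rfl | rfl := hE₂ <;>
        simp only [Label.setBranch, Ctrl.can_inArg_letRet, Ctrl.can_inArg_appGlobal]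
          at hs₁ hs₂ ⊢ <;>
        exact ih₁ hl hP₁ hP₂ hs₁ hs₂
  | funLocal ℓ C ih =>
    obtain ⟨_, s₁⟩ := hs₁
    by_cases h : ℓ = ℓ₁ <;> simp [Chor.proj, h, Option.bind_eq_some_iff] at h₁ <;>
      obtain ⟨_, -, rfl⟩ := h₁ <;> cases s₁
  | funGlobal C ih =>
    obtain ⟨_, s₁⟩ := hs₁
    simp [Chor.proj, Option.bind_eq_some_iff] at h₁
    obtain ⟨_, -, rfl⟩ := h₁
    cases s₁
  | appLocal ℓ C e ih =>
    have key : ∀ {ℓ₀ : Loc} {E : Ctrl Loc Expr}, (Chor.appLocal ℓ C e).proj ℓ₀ = some E →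
        ∃ P, C.proj ℓ₀ = some P ∧ (E = .appLocal P e ∨ E = .appGlobal P .unit) := by
      intro ℓ₀ E hE
      by_cases h : ℓ = ℓ₀ <;> simp [Chor.proj, h, Option.bind_eq_some_iff] at hE <;>
        obtain ⟨P, hP, rfl⟩ := hE
      · exact ⟨P, hP, .inl rfl⟩
      · exact ⟨P, hP, .inr rfl⟩
    obtain ⟨P₁, hP₁, hE₁⟩ := key h₁
    obtain ⟨P₂, hP₂, hE₂⟩ := key h₂
    cases hl with
    | choice => obtain ⟨_, s₁⟩ := hs₁; obtain rfl | rfl := hE₁ <;> cases s₁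
    | inFun hl =>
      obtain rfl | rfl := hE₁ <;> obtain rfl | rfl := hE₂ <;>
        simp only [Label.setBranch, Ctrl.can_inFun_appLocal, Ctrl.can_inFun_appGlobal]
          at hs₁ hs₂ ⊢ <;>
        exact ih hl hP₁ hP₂ hs₁ hs₂
    | inArg hl =>
      obtain ⟨_, s₁⟩ := hs₁
      obtain rfl | rfl := hE₁
      · cases s₁
      · cases s₁ with | appGlobalArg s₁ => cases s₁
  | appGlobal C₁ C₂ ih₁ ih₂ =>
    simp [Chor.proj, Option.bind_eq_some_iff] at h₁ h₂
    obtain ⟨P₁, hP₁, Q₁, hQ₁, rfl⟩ := h₁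
    obtain ⟨P₂, hP₂, Q₂, hQ₂, rfl⟩ := h₂
    cases hl with
    | choice => obtain ⟨_, s₁⟩ := hs₁; cases s₁
    | inFun hl =>
      simp only [Label.setBranch, Ctrl.can_inFun_appGlobal] at hs₁ hs₂ ⊢
      exact ih₁ hl hP₁ hP₂ hs₁ hs₂
    | inArg hl =>
      simp only [Label.setBranch, Ctrl.can_inArg_appGlobal] at hs₁ hs₂ ⊢
      exact ih₂ hl hQ₁ hQ₂ hs₁ hs₂

/-! ### Systems -/

theorem System.LND.update {S₁ S₂ : System Loc Expr} (h : System.LND S₁ S₂) (ℓ : Loc)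
    {E₁ E₂ : Ctrl Loc Expr} (hE : Ctrl.LND E₁ E₂) :
    System.LND (S₁.update ℓ E₁) (S₂.update ℓ E₂) := by
  intro ℓ' E hE'
  by_cases hℓ : ℓ' = ℓ
  · subst hℓ
    simp only [System.update, if_true, Option.map_eq_some_iff] at hE' ⊢
    obtain ⟨F, hF, rfl⟩ := hE'
    obtain ⟨F', hF', -⟩ := h _ _ hF
    exact ⟨E₂, ⟨F', hF', rfl⟩, hE⟩
  · simp only [System.update, if_neg hℓ] at hE' ⊢
    exact h _ _ hE'

theorem System.mem_locs_iff {S : System Loc Expr} {ℓ : Loc} :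
    ℓ ∈ S.locs ↔ ∃ E, S.lookup ℓ = some E :=
  Option.ne_none_iff_exists'

/-- The relation on systems only transfers definedness from left to right; equality of the location
sets supplies the converse. -/
theorem System.LND.exists_left {S₁ S₂ : System Loc Expr} (h : System.LND S₁ S₂)
    (hlocs : S₁.locs = S₂.locs) {ℓ : Loc} {E₂ : Ctrl Loc Expr} (hE : S₂.lookup ℓ = some E₂) :
    ∃ E₁, S₁.lookup ℓ = some E₁ ∧ Ctrl.LND E₁ E₂ := by
  obtain ⟨E₁, h₁⟩ : ∃ E₁, S₁.lookup ℓ = some E₁ := by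
    rw [← System.mem_locs_iff, hlocs, System.mem_locs_iff]
    exact ⟨_, hE⟩
  obtain ⟨E, hE', hL⟩ := h _ _ h₁
  obtain rfl : E₂ = E := Option.some.inj (hE.symm.trans hE')
  exact ⟨E₁, h₁, hL⟩

/-- A system can be built by choosing a program at each location of a given one. -/
theorem System.exists_of_forall (S : System Loc Expr) (Q : Loc → Ctrl Loc Expr → Prop)
    (h : ∀ ℓ ∈ S.locs, ∃ E, Q ℓ E) :
    ∃ S' : System Loc Expr, S'.locs = S.locs ∧ ∀ ℓ E, S'.lookup ℓ = some E → Q ℓ E := by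
  classical
  choose f hf using h
  let g : Loc → Option (Ctrl Loc Expr) := fun ℓ => if hℓ : ℓ ∈ S.locs then some (f ℓ hℓ) else none
  have hg : {ℓ | g ℓ ≠ none} = S.locs := by
    ext ℓ
    simp [g]
  refine ⟨⟨g, hg ▸ S.finite_locs⟩, hg, fun ℓ E hE => ?_⟩
  simp only [g] at hE
  split_ifs at hE with hℓ
  obtain rfl := Option.some.inj hE
  exact hf ℓ hℓ

theorem Chor.lookup_of_projSystem {C : Chor Loc Expr} {𝔏 : Finset Loc} {S : System Loc Expr}
    (h : C.projSystem 𝔏 = some S) {ℓ : Loc} {E : Ctrl Loc Expr} (hE : S.lookup ℓ = some E) :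
    C.proj ℓ = some E := by
  unfold Chor.projSystem at h
  split_ifs at h
  obtain rfl := Option.some.inj h
  simp only at hE
  split_ifs at hE
  exact hE

theorem System.Step.lift [LocalLang Expr] {L : SysLabel Loc Expr} {S₁ S₁' S₂ : System Loc Expr}
    (hs : System.Step L S₁ S₁') (hlocs : S₁.locs = S₂.locs) (h : System.LND S₁ S₂) :
    ∃ S₂', System.LND S₁' S₂' ∧ System.Step L S₂ S₂' := by
  cases hs with
  | internal hl hE s =>
    obtain ⟨F, hF, hL⟩ := h _ _ hE
    obtain ⟨F', hL', s'⟩ := s.lift hL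
    exact ⟨_, h.update _ hL', .internal hl hF s'⟩
  | @syncInternal _ _ l hl hlocs' hall =>
    obtain ⟨S₂', hS₂', hQ⟩ := S₂.exists_of_forall
      -- All locations step at once, so the new system is chosen pointwise, each program being
      -- required both to be reached by the step and to dominate `S₁'`.
      (fun ℓ E' => (∀ E, S₂.lookup ℓ = some E → Ctrl.Step l E E') ∧
        ∀ F', S₁'.lookup ℓ = some F' → Ctrl.LND F' E') (by
        intro ℓ hℓ
        obtain ⟨F, hF⟩ := System.mem_locs_iff.1 (hlocs ▸ hℓ)
        obtain ⟨F', hF'⟩ := System.mem_locs_iff.1 (hlocs' ▸ hlocs ▸ hℓ)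
        obtain ⟨E, hE, hL⟩ := h _ _ hF
        obtain ⟨E', hL', s'⟩ := (hall _ _ _ hF hF').lift hL
        simp only [hE, hF', Option.some.injEq, forall_eq']
        exact ⟨E', s', hL'⟩)
    refine ⟨S₂', fun ℓ F' hF' => ?_,
      .syncInternal hl hS₂' fun ℓ E E' hE hE' => (hQ _ _ hE').1 _ hE⟩
    obtain ⟨E', hE'⟩ : ∃ E', S₂'.lookup ℓ = some E' := by
      rw [← System.mem_locs_iff, hS₂', ← hlocs, ← hlocs', System.mem_locs_iff]
      exact ⟨_, hF'⟩
    exact ⟨E', hE', (hQ _ _ hE').2 _ hF'⟩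
  | comm hne hl hE₁ s₁ hE₂ s₂ =>
    obtain ⟨F₁, hF₁, hL₁⟩ := h _ _ hE₁
    obtain ⟨F₂, hF₂, hL₂⟩ := h _ _ hE₂
    obtain ⟨F₁', hL₁', s₁'⟩ := s₁.lift hL₁
    obtain ⟨F₂', hL₂', s₂'⟩ := s₂.lift hL₂
    exact ⟨_, (h.update _ hL₁').update _ hL₂', .comm hne hl hF₁ s₁' hF₂ s₂'⟩
  | choice hne hl hE₁ s₁ hE₂ s₂ =>
    obtain ⟨F₁, hF₁, hL₁⟩ := h _ _ hE₁
    obtain ⟨F₂, hF₂, hL₂⟩ := h _ _ hE₂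
    obtain ⟨F₁', hL₁', s₁'⟩ := s₁.lift hL₁
    obtain ⟨F₂', hL₂', s₂'⟩ := s₂.lift hL₂
    exact ⟨_, (h.update _ hL₁').update _ hL₂', .choice hne hl hF₁ s₁' hF₂ s₂'⟩

theorem System.Step.lower [LocalLang Expr] {L : SysLabel Loc Expr} {S₁ S₂ S₂' : System Loc Expr}
    (hs : System.Step L S₂ S₂') (hlocs : S₁.locs = S₂.locs) (h : System.LND S₁ S₂)
    {C : Chor Loc Expr} {𝔏 : Finset Loc} (hC : C.projSystem 𝔏 = some S₁) :
    ∃ S₁', System.LND S₁' S₂' ∧ System.Step L S₁ S₁' := by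
  cases hs with
  | internal hl hE s =>
    obtain ⟨F, hF, hL⟩ := h.exists_left hlocs hE
    obtain ⟨F', hL', s'⟩ := s.lower_of_setBranch_eq hL hl.setBranch_left
    exact ⟨_, h.update _ hL', .internal hl hF s'⟩
  | @syncInternal _ _ l hl hlocs' hall =>
    obtain ⟨S₁', hS₁', hQ⟩ := S₁.exists_of_forall
      (fun ℓ E' => (∀ E, S₁.lookup ℓ = some E → Ctrl.Step l E E') ∧
        -- Existential this time: the new system is the smaller one, so the relation itself demands
        -- that `S₂'` be defined at `ℓ`.
        ∃ F', S₂'.lookup ℓ = some F' ∧ Ctrl.LND E' F') (by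
        intro ℓ hℓ
        obtain ⟨E, hE⟩ := System.mem_locs_iff.1 hℓ
        obtain ⟨F, hF, hL⟩ := h _ _ hE
        obtain ⟨F', hF'⟩ := System.mem_locs_iff.1 (hlocs' ▸ hlocs ▸ hℓ)
        obtain ⟨E', hL', s'⟩ := (hall _ _ _ hF hF').lower_of_setBranch_eq hL hl.setBranch_left
        simp only [hE, hF', Option.some.injEq, forall_eq', exists_eq_left']
        exact ⟨E', s', hL'⟩)
    exact ⟨S₁', fun ℓ E' hE' => (hQ _ _ hE').2,
      .syncInternal hl hS₁' fun ℓ E E' hE hE' => (hQ _ _ hE').1 _ hE⟩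
  | comm hne hl hE₁ s₁ hE₂ s₂ =>
    obtain ⟨F₁, hF₁, hL₁⟩ := h.exists_left hlocs hE₁
    obtain ⟨F₂, hF₂, hL₂⟩ := h.exists_left hlocs hE₂
    obtain ⟨F₁', hL₁', s₁'⟩ := s₁.lower_of_setBranch_eq hL₁ hl.setBranch_left
    obtain ⟨F₂', hL₂', s₂'⟩ := s₂.lower_of_setBranch_eq hL₂ hl.setBranch_right_of_comm
    exact ⟨_, (h.update _ hL₁').update _ hL₂', .comm hne hl hF₁ s₁' hF₂ s₂'⟩
  | choice hne hl hE₁ s₁ hE₂ s₂ =>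
    obtain ⟨F₁, hF₁, hL₁⟩ := h.exists_left hlocs hE₁
    obtain ⟨F₂, hF₂, hL₂⟩ := h.exists_left hlocs hE₂
    obtain ⟨F₁', hL₁', s₁'⟩ := s₁.lower_of_setBranch_eq hL₁ hl.setBranch_left
    -- The only use of projectability: a receiver waiting with some branch must offer the one that
    -- the sender, already lowered, selects.
    obtain ⟨F₂', hL₂', s₂'⟩ := (s₂.lower hL₂).resolve_right fun ⟨hn, d', hd'⟩ =>
      hn (Chor.can_allow_of_can_choose hne hl (Chor.lookup_of_projSystem hC hF₁)
        (Chor.lookup_of_projSystem hC hF₂) ⟨_, s₁'⟩ hd')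
    exact ⟨_, (h.update _ hL₁').update _ hL₂', .choice hne hl hF₁ s₁' hF₂ s₂'⟩

end Pirouette

theorem mainTheorem6 {Loc : Type u} {Expr : Type v} [Pirouette.LocalLang Expr]
    (S₁ S₂ : Pirouette.System Loc Expr) (hlocs : S₁.locs = S₂.locs)
    (hLND : Pirouette.System.LND S₁ S₂) :
    (∀ (L : Pirouette.SysLabel Loc Expr) (S₁' : Pirouette.System Loc Expr),
      Pirouette.System.Step L S₁ S₁' →
        ∃ S₂' : Pirouette.System Loc Expr,
          Pirouette.System.LND S₁' S₂' ∧ Pirouette.System.Step L S₂ S₂') ∧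
    (∀ (L : Pirouette.SysLabel Loc Expr) (S₂' : Pirouette.System Loc Expr)
      (C : Pirouette.Chor Loc Expr) (𝔏 : Finset Loc),
      Pirouette.System.Step L S₂ S₂' → C.projSystem 𝔏 = some S₁ →
        ∃ S₁' : Pirouette.System Loc Expr,
          Pirouette.System.LND S₁' S₂' ∧ Pirouette.System.Step L S₁ S₁') :=
  ⟨fun _ _ hs => hs.lift hlocs hLND, fun _ _ _ _ hs hC => hs.lower hlocs hLND hC⟩
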